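/- Let $(N,g)$ be a smooth ($C^\infty$) Riemannian manifold with Levi-Civita connection $\nabla$, and let $M\subset N$ be a smooth Riemannian submanifold of codimension $r$, that is, $\dim N=\dim M+r$ and $M$ carries the Riemannian metric induced by $g$. A smooth vector field of $N$ along $M$, i.e. a smooth map $Y\colon M\to TN$ with $Y(x)\in T_xN$ for all $x\in M$, is called parallel along $M$ if $\nabla_W Y=0$ for every $W\in TM$. Let $X_1,\dots,X_r\colon M\to TN$ be vector fields parallel along $M$ such that, for every $x\in M$, $\{X_1(x),\dots,X_r(x)\}$ is a basis of the normal space $T_xM^\perp\subset T_xN$. Then $M$ is a totally geodesic submanifold of $N$: every geodesic of $M$ (for the induced metric) is a geodesic of $N$. -/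

import Mathlib

noncomputable section

namespace RiemSub

/-- Christoffel symbols of the first kind at `y` of the metric `g` on an open set of `E`:
`w ↦ (∂_u g(v, w) + ∂_v g(u, w) - ∂_w g(u, v)) / 2`. -/
def christoffelLower {E : Type*} [NormedAddCommGroup E] [NormedSpace ℝ E]
    (g : E → E →L[ℝ] E →L[ℝ] ℝ) (y u v : E) : E →L[ℝ] ℝ :=
  let Dg : E →L[ℝ] E →L[ℝ] E →L[ℝ] ℝ := fderiv ℝ g y
  (1 / 2 : ℝ) • (Dg u v + Dg v u - (Dg.flip u).flip v)

end RiemSub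

end

open Bundle Manifold
open scoped ContDiff

noncomputable section

namespace RiemSub

section LeviCivita

variable {E : Type*} [NormedAddCommGroup E] [NormedSpace ℝ E]
  {N : Type*} [TopologicalSpace N] [ChartedSpace E N] [IsManifold 𝓘(ℝ, E) ∞ N]
  [RiemannianBundle (fun x : N ↦ TangentSpace 𝓘(ℝ, E) x)]

/-- The Riemannian metric of `N` written in the preferred chart `φ` at `x`:
`metricInChart x y u v` is `g_q (∂_u, ∂_v)`, where `q = φ⁻¹ y` and `∂_u` is the tangent vector
at `q` whose coordinates in the chart `φ` are `u`. It is meaningful for `y` in the target of `φ`,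
an open subset of `E`. -/
def metricInChart (x : N) (y : E) : E →L[ℝ] E →L[ℝ] ℝ :=
  let q : N := (extChartAt 𝓘(ℝ, E) x).symm y
  let coordVec : E →L[ℝ] TangentSpace 𝓘(ℝ, E) q :=
    (trivializationAt E (TangentSpace 𝓘(ℝ, E)) x).symmL ℝ q
  (innerSL ℝ (E := TangentSpace 𝓘(ℝ, E) q)).bilinearComp coordVec coordVec

/-- Christoffel symbols (of the second kind) at `x`, in the preferred chart at `x`: the vector
`Γ_x(u, v)` whose inner products `g_x (Γ_x(u, v), w)` are the Christoffel symbols of the first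
kind. Recall that `TangentSpace 𝓘(ℝ, E) x` is identified with `E` through the preferred chart
at `x`. -/
def christoffel [FiniteDimensional ℝ E] (x : N) (u v : TangentSpace 𝓘(ℝ, E) x) :
    TangentSpace 𝓘(ℝ, E) x :=
  haveI : FiniteDimensional ℝ (TangentSpace 𝓘(ℝ, E) x) := inferInstanceAs (FiniteDimensional ℝ E)
  haveI : CompleteSpace (TangentSpace 𝓘(ℝ, E) x) := FiniteDimensional.complete ℝ _
  let Γ : TangentSpace 𝓘(ℝ, E) x →L[ℝ] ℝ :=
    christoffelLower (E := E) (metricInChart x) (extChartAt 𝓘(ℝ, E) x x) u v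
  (InnerProductSpace.toDual ℝ (TangentSpace 𝓘(ℝ, E) x)).symm Γ

variable {F : Type*} [NormedAddCommGroup F] [NormedSpace ℝ F]
  {P : Type*} [TopologicalSpace P] [ChartedSpace F P]

/-- `Y` is a smooth vector field of `N` along the map `f : P → N`. -/
def IsSmoothFieldAlong (f : P → N) (Y : ∀ p, TangentSpace 𝓘(ℝ, E) (f p)) : Prop :=
  ContMDiff 𝓘(ℝ, F) 𝓘(ℝ, E).tangent ∞ (fun p ↦ (⟨f p, Y p⟩ : TangentBundle 𝓘(ℝ, E) N))

/-- The covariant derivative `∇_W Y` at `p`, for the Levi-Civita connection `∇` of `N`, of a vector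
field `Y` of `N` along the map `f : P → N`, in the direction `W ∈ T_p P`. In the preferred chart
at `f p` it is `∂_W Y + Γ(df W, Y)`. -/
def covDerivAlong [FiniteDimensional ℝ E] (f : P → N) (Y : ∀ p, TangentSpace 𝓘(ℝ, E) (f p))
    (p : P) (W : TangentSpace 𝓘(ℝ, F) p) : TangentSpace 𝓘(ℝ, E) (f p) :=
  let Yc : P → E := fun q ↦
    (trivializationAt E (TangentSpace 𝓘(ℝ, E)) (f p) ⟨f q, Y q⟩).2
  let dYc : TangentSpace 𝓘(ℝ, E) (f p) := mfderiv 𝓘(ℝ, F) 𝓘(ℝ, E) Yc p W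
  dYc + christoffel (f p) (mfderiv 𝓘(ℝ, F) 𝓘(ℝ, E) f p W) (Y p)

/-- `Y` is a smooth vector field of `N` along `f`, parallel along `f`: `∇_W Y = 0` for every
tangent vector `W` of the source. -/
structure IsParallelAlong [FiniteDimensional ℝ E] (f : P → N)
    (Y : ∀ p, TangentSpace 𝓘(ℝ, E) (f p)) : Prop where
  smooth : IsSmoothFieldAlong (F := F) f Y
  parallel : ∀ (p : P) (W : TangentSpace 𝓘(ℝ, F) p), covDerivAlong f Y p W = 0

/-- The velocity field of a curve. -/
def velocity (γ : ℝ → N) (t : ℝ) : TangentSpace 𝓘(ℝ, E) (γ t) :=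
  mfderiv 𝓘(ℝ, ℝ) 𝓘(ℝ, E) γ t (1 : ℝ)

/-- The restriction of `γ` to the open set `J` is a smooth curve in `N` which satisfies
the geodesic equation `∇_{γ'} γ' = 0`. -/
structure IsGeodesicOn [FiniteDimensional ℝ E] (γ : ℝ → N) (J : Set ℝ) : Prop where
  smooth : ContMDiffOn 𝓘(ℝ, ℝ) 𝓘(ℝ, E) ∞ γ J
  geodesic : ∀ t ∈ J, covDerivAlong (F := ℝ) γ (velocity (E := E) γ) t (1 : ℝ) = 0

end LeviCivita

section Submanifold

variable {E' : Type*} [NormedAddCommGroup E'] [NormedSpace ℝ E']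
  {M : Type*} [TopologicalSpace M] [ChartedSpace E' M] [IsManifold 𝓘(ℝ, E') ∞ M]
  [RiemannianBundle (fun x : M ↦ TangentSpace 𝓘(ℝ, E') x)]
  {E : Type*} [NormedAddCommGroup E] [NormedSpace ℝ E]
  {N : Type*} [TopologicalSpace N] [ChartedSpace E N] [IsManifold 𝓘(ℝ, E) ∞ N]
  [RiemannianBundle (fun x : N ↦ TangentSpace 𝓘(ℝ, E) x)]

/-- The inclusion `ι : M → N` makes `M` a Riemannian submanifold of `N`: it is a smooth injective
immersion, and the metric of `M` is the one induced by `N`. -/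
structure IsRiemannianSubmanifold (ι : M → N) : Prop where
  immersion : IsImmersion 𝓘(ℝ, E') 𝓘(ℝ, E) ∞ ι
  injective : Function.Injective ι
  isometric : ∀ (x : M) (u v : TangentSpace 𝓘(ℝ, E') x),
    inner ℝ (mfderiv 𝓘(ℝ, E') 𝓘(ℝ, E) ι x u) (mfderiv 𝓘(ℝ, E') 𝓘(ℝ, E) ι x v) = inner ℝ u v

/-- The normal space `T_xM^⊥ ⊆ T_{ι x}N`. -/
def normalSpace (ι : M → N) (x : M) : Submodule ℝ (TangentSpace 𝓘(ℝ, E) (ι x)) :=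
  (mfderiv 𝓘(ℝ, E') 𝓘(ℝ, E) ι x).toLinearMap.rangeᗮ

/-- Every geodesic of `M` (defined on any open interval) is a geodesic of `N`. -/
def IsTotallyGeodesic [FiniteDimensional ℝ E'] [FiniteDimensional ℝ E] (ι : M → N) : Prop :=
  ∀ (γ : ℝ → M) (J : Set ℝ), IsOpen J → J.OrdConnected →
    IsGeodesicOn (E := E') γ J → IsGeodesicOn (E := E) (ι ∘ γ) J

end Submanifold

end RiemSub

end

noncomputable section

namespace RiemSub

open scoped Topology

/-! ### Calculus of metrics and curves in a vector space -/

section Calculus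

variable {E : Type*} [NormedAddCommGroup E] [NormedSpace ℝ E]
  {E' : Type*} [NormedAddCommGroup E'] [NormedSpace ℝ E']

/-! Let `D` be the acceleration in `N` of a geodesic `γ` of `M`. Differentiating `g(γ', X_j) = 0`
along `γ` gives `g(D, X_j) = -g(γ', ∇_{γ'} X_j) = 0`, because `X_j` is parallel
(`inner_acceleration_parallel`). The `X_j` span the normal space, so `D` is tangent to `M`, say `D =
dι w`.

By the Gauss formula, the tangential part of `D` is the acceleration of `γ` in `M`
(`inner_acceleration_mfderiv`), which vanishes. Hence `g(D, D) = g(D, dι w) = 0`.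

Both facts are local, and the covariant derivative at a point is defined in the preferred chart
there. They therefore reduce to two computations with Christoffel symbols in a vector space:
`acceleration_orthogonal_of_parallel` (metric compatibility) and `acceleration_comp` (symbols of a
pulled back metric). -/

lemma differentiableAt_deriv {c : ℝ → E} {t : ℝ} (hc : ContDiffAt ℝ 2 c t) :
    DifferentiableAt ℝ (deriv c) t := by
  have h : DifferentiableAt ℝ (fun s ↦ fderiv ℝ c s 1) t :=
    ((hc.fderiv_right (m := 1) (by norm_num)).differentiableAt (by norm_num)).clm_apply
      (differentiableAt_const _)
  exact h

lemma christoffelLower_apply (g : E → E →L[ℝ] E →L[ℝ] ℝ) (y u v w : E) :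
    christoffelLower g y u v w
      = (fderiv ℝ g y u v w + fderiv ℝ g y v u w - fderiv ℝ g y w u v) / 2 := by
  simp [christoffelLower]
  ring

lemma fderiv_symm_of_symm {g : E → E →L[ℝ] E →L[ℝ] ℝ} {y : E} (hg : DifferentiableAt ℝ g y)
    (hsymm : ∀ z u v, g z u v = g z v u) (u v w : E) :
    fderiv ℝ g y u v w = fderiv ℝ g y u w v := by
  have key : ∀ a b, HasFDerivAt (fun z ↦ g z a b)
      (((fderiv ℝ g y).flip a).flip b) y := fun a b ↦ by
    simpa using! (hg.hasFDerivAt.clm_apply (hasFDerivAt_const a y)).clm_apply (hasFDerivAt_const b y)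
  have h := (key v w).unique ((key w v).congr_of_eventuallyEq (.of_forall fun z ↦ hsymm z v w))
  exact congr($h u)

set_option synthInstance.maxHeartbeats 200000 in
/-- Christoffel symbols of the first kind of a pulled back metric. -/
lemma christoffelLower_pullback {g : E → E →L[ℝ] E →L[ℝ] ℝ} {h : E' → E' →L[ℝ] E' →L[ℝ] ℝ}
    {f : E' → E} {y : E'} (hf : ContDiffAt ℝ 2 f y) (hg : DifferentiableAt ℝ g (f y))
    (hh : DifferentiableAt ℝ h y) (hsymm : ∀ z u v, g z u v = g z v u)
    (hpull : ∀ᶠ z in 𝓝 y, ∀ u v, h z u v = g (f z) (fderiv ℝ f z u) (fderiv ℝ f z v))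
    (u v w : E') :
    christoffelLower h y u v w
      = christoffelLower g (f y) (fderiv ℝ f y u) (fderiv ℝ f y v) (fderiv ℝ f y w)
        + g (f y) (fderiv ℝ (fderiv ℝ f) y u v) (fderiv ℝ f y w) := by
  have hf1 : HasFDerivAt f (fderiv ℝ f y) y := (hf.differentiableAt (by norm_num)).hasFDerivAt
  have hf2 : HasFDerivAt (fderiv ℝ f) (fderiv ℝ (fderiv ℝ f) y) y :=
    ((hf.fderiv_right (m := 1) (by norm_num)).differentiableAt (by norm_num)).hasFDerivAt
  have hgf : HasFDerivAt (fun z ↦ g (f z)) (fderiv ℝ g (f y) ∘L fderiv ℝ f y) y :=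
    HasFDerivAt.comp (g := g) (g' := fderiv ℝ g (f y)) y hg.hasFDerivAt hf1
  have hs : ∀ a b, fderiv ℝ (fderiv ℝ f) y a b = fderiv ℝ (fderiv ℝ f) y b a :=
    hf.isSymmSndFDerivAt (by simp)
  -- Product rule for `h = g(f)(df ·, df ·)`.
  have key : ∀ a b c, fderiv ℝ h y a b c =
      fderiv ℝ g (f y) (fderiv ℝ f y a) (fderiv ℝ f y b) (fderiv ℝ f y c)
      + g (f y) (fderiv ℝ (fderiv ℝ f) y a b) (fderiv ℝ f y c)
      + g (f y) (fderiv ℝ f y b) (fderiv ℝ (fderiv ℝ f) y a c) := by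
    intro a b c
    have h1 : HasFDerivAt (fun z ↦ h z b c) (((fderiv ℝ h y).flip b).flip c) y := by
      simpa using!
        (hh.hasFDerivAt.clm_apply (hasFDerivAt_const b y)).clm_apply (hasFDerivAt_const c y)
    have h2 := (hgf.clm_apply (hf2.clm_apply (hasFDerivAt_const b y))).clm_apply
      (hf2.clm_apply (hasFDerivAt_const c y))
    have h3 := h1.unique (h2.congr_of_eventuallyEq (hpull.mono fun z hz ↦ hz b c))
    have h4 := congr($h3 a)
    simp at h4
    linarith
  -- Six terms contain second derivatives of `f`. By symmetry of `g` and of the Hessian, four cancel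
  -- and the other two are equal, which absorbs the factor `1/2`.
  rw [christoffelLower_apply, christoffelLower_apply, key, key, key, hs v u, hs w u, hs w v,
    hsymm (f y) (fderiv ℝ f y v) (fderiv ℝ (fderiv ℝ f) y u w),
    hsymm (f y) (fderiv ℝ f y u) (fderiv ℝ (fderiv ℝ f) y v w)]
  ring

set_option synthInstance.maxHeartbeats 200000 in
/-- If the velocity of `c` is orthogonal to a field `Y` along `c` which is parallel at `t`, then
so is its acceleration at `t`. -/
lemma acceleration_orthogonal_of_parallel {g : E → E →L[ℝ] E →L[ℝ] ℝ} {c Y : ℝ → E} {t : ℝ}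
    {Γ : E →  E → E} (hg : DifferentiableAt ℝ g (c t)) (hsymm : ∀ z u v, g z u v = g z v u)
    (hΓ : ∀ u v w, g (c t) (Γ u v) w = christoffelLower g (c t) u v w)
    (hc : DifferentiableAt ℝ c t) (hc' : DifferentiableAt ℝ (deriv c) t)
    (hY : HasDerivAt Y (- Γ (deriv c t) (Y t)) t)
    (horth : ∀ᶠ s in 𝓝 t, g (c s) (deriv c s) (Y s) = 0) :
    g (c t) (deriv (deriv c) t + Γ (deriv c t) (deriv c t)) (Y t) = 0 := by
  have h1 : HasDerivAt (fun s ↦ g (c s)) (fderiv ℝ g (c t) (deriv c t)) t :=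
    HasFDerivAt.comp_hasDerivAt (l := g) (l' := fderiv ℝ g (c t)) t hg.hasFDerivAt hc.hasDerivAt
  have h2 := (h1.clm_apply hc'.hasDerivAt).clm_apply hY
  have h3 := h2.unique ((hasDerivAt_const t (0 : ℝ)).congr_of_eventuallyEq horth)
  have h4 := hΓ (deriv c t) (Y t) (deriv c t)
  have h5 := hΓ (deriv c t) (deriv c t) (Y t)
  rw [hsymm] at h4
  rw [christoffelLower_apply] at h4 h5
  have h6 := fderiv_symm_of_symm hg hsymm (deriv c t) (Y t) (deriv c t)
  simp at h3 ⊢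
  linarith

/-- For an isometric immersion `f`, the tangential component of the acceleration of `f ∘ c` is the
image of the acceleration of `c`. -/
lemma acceleration_comp {g : E → E →L[ℝ] E →L[ℝ] ℝ} {h : E' → E' →L[ℝ] E' →L[ℝ] ℝ}
    {f : E' → E} {c : ℝ → E'} {t : ℝ} {Γ : E → E → E} {Γ' : E' → E' → E'}
    (hf : ContDiffAt ℝ 2 f (c t)) (hg : DifferentiableAt ℝ g (f (c t)))
    (hh : DifferentiableAt ℝ h (c t)) (hsymm : ∀ z u v, g z u v = g z v u)
    (hpull : ∀ᶠ z in 𝓝 (c t), ∀ u v, h z u v = g (f z) (fderiv ℝ f z u) (fderiv ℝ f z v))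
    (hΓ : ∀ u v w, g (f (c t)) (Γ u v) w = christoffelLower g (f (c t)) u v w)
    (hΓ' : ∀ u v w, h (c t) (Γ' u v) w = christoffelLower h (c t) u v w)
    (hc : ContDiffAt ℝ 2 c t) (w : E') :
    g (f (c t)) (deriv (deriv (f ∘ c)) t + Γ (deriv (f ∘ c) t) (deriv (f ∘ c) t))
        (fderiv ℝ f (c t) w)
      = h (c t) (deriv (deriv c) t + Γ' (deriv c t) (deriv c t)) w := by
  have hcont := hc.continuousAt
  have h1 : ∀ᶠ s in 𝓝 t, deriv (f ∘ c) s = fderiv ℝ f (c s) (deriv c s) := by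
    filter_upwards [hcont.eventually (hf.eventually (by simp)), hc.eventually (by simp)] with s a b
    exact ((a.differentiableAt (by norm_num)).hasFDerivAt.comp_hasDerivAt s
      (b.differentiableAt (by norm_num)).hasDerivAt).deriv
  have hc1 : HasDerivAt c (deriv c t) t := (hc.differentiableAt (by norm_num)).hasDerivAt
  have hc2 : HasDerivAt (deriv c) (deriv (deriv c) t) t :=
    (differentiableAt_deriv hc).hasDerivAt
  have hf2 : HasFDerivAt (fderiv ℝ f) (fderiv ℝ (fderiv ℝ f) (c t)) (c t) :=
    ((hf.fderiv_right (m := 1) (by norm_num)).differentiableAt (by norm_num)).hasFDerivAt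
  -- `(f ∘ c)'' = D²f(c', c') + df(c'')`; the Hessian term is the correction in
  -- `christoffelLower_pullback`.
  have h2 := ((hf2.comp_hasDerivAt t hc1).clm_apply hc2).congr_of_eventuallyEq h1
  have h3 := hpull.self_of_nhds (deriv (deriv c) t) w
  rw [h2.deriv, h1.self_of_nhds, map_add, map_add, map_add, add_apply,
    add_apply, add_apply, hΓ, hΓ',
    christoffelLower_pullback hf hg hh hsymm hpull, h3]
  simp only [Function.comp_apply]
  ring

end Calculus

/-! ### Tangent vectors and the metric in the preferred chart -/

section Charts

variable {E : Type*} [NormedAddCommGroup E] [NormedSpace ℝ E]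
  {N : Type*} [TopologicalSpace N] [ChartedSpace E N] [IsManifold 𝓘(ℝ, E) ∞ N]

lemma trivializationAt_apply_self (x : N) (v : TangentSpace 𝓘(ℝ, E) x) :
    (trivializationAt E (TangentSpace 𝓘(ℝ, E)) x ⟨x, v⟩).2 = v := by
  exact tangentCoordChange_self (I := 𝓘(ℝ, E)) (mem_extChartAt_source x)

lemma symmL_trivializationAt_self (x : N) (v : E) :
    (trivializationAt E (TangentSpace 𝓘(ℝ, E)) x).symmL ℝ x v = v := by
  have hx : x ∈ (chartAt E x).source := mem_chart_source E x
  rw [TangentBundle.symmL_trivializationAt_eq_core hx]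
  exact tangentCoordChange_self (I := 𝓘(ℝ, E)) (mem_extChartAt_source x)

/-- A tangent vector is recovered from its coordinates. -/
lemma symmL_trivializationAt_apply {x q : N} (hq : q ∈ (chartAt E x).source)
    (v : TangentSpace 𝓘(ℝ, E) q) :
    (trivializationAt E (TangentSpace 𝓘(ℝ, E)) x).symmL ℝ q
      (trivializationAt E (TangentSpace 𝓘(ℝ, E)) x ⟨q, v⟩).2 = v := by
  have := (trivializationAt E (TangentSpace 𝓘(ℝ, E)) x).symmL_continuousLinearMapAt
    (R := ℝ) (b := q) hq v
  rwa [Trivialization.continuousLinearMapAt_apply_of_mem (R := ℝ)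
    (trivializationAt E (TangentSpace 𝓘(ℝ, E)) x) (b := q) hq] at this

/-- The coordinates of `df u` are given by the derivative of the coordinate expression of `f`. -/
lemma mfderiv_symmL {E' : Type*} [NormedAddCommGroup E'] [NormedSpace ℝ E']
    {M : Type*} [TopologicalSpace M] [ChartedSpace E' M] [IsManifold 𝓘(ℝ, E') ∞ M]
    {f : M → N} {x q : M} {p : N} (hq : q ∈ (chartAt E' x).source)
    (hp : f q ∈ (chartAt E p).source) (hf : MDifferentiableAt 𝓘(ℝ, E') 𝓘(ℝ, E) f q) (u : E') :
    mfderiv 𝓘(ℝ, E') 𝓘(ℝ, E) f q ((trivializationAt E' (TangentSpace 𝓘(ℝ, E')) x).symmL ℝ q u)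
      = (trivializationAt E (TangentSpace 𝓘(ℝ, E)) p).symmL ℝ (f q)
        (fderiv ℝ (extChartAt 𝓘(ℝ, E) p ∘ f ∘ (extChartAt 𝓘(ℝ, E') x).symm)
          (extChartAt 𝓘(ℝ, E') x q) u) := by
  have hsymm : (extChartAt 𝓘(ℝ, E') x).symm (extChartAt 𝓘(ℝ, E') x q) = q :=
    (extChartAt 𝓘(ℝ, E') x).left_inv (by simpa using hq)
  have h1 : MDifferentiableAt 𝓘(ℝ, E') 𝓘(ℝ, E') (extChartAt 𝓘(ℝ, E') x).symm
      (extChartAt 𝓘(ℝ, E') x q) := by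
    simpa [mdifferentiableWithinAt_univ] using mdifferentiableWithinAt_extChartAt_symm
      (I := 𝓘(ℝ, E')) ((extChartAt 𝓘(ℝ, E') x).map_source (by simpa using hq))
  have h2 : MDifferentiableAt 𝓘(ℝ, E) 𝓘(ℝ, E) (extChartAt 𝓘(ℝ, E) p) (f q) :=
    mdifferentiableAt_extChartAt hp
  have h3 : HasMFDerivAt 𝓘(ℝ, E') 𝓘(ℝ, E) (extChartAt 𝓘(ℝ, E) p ∘ f)
      ((extChartAt 𝓘(ℝ, E') x).symm (extChartAt 𝓘(ℝ, E') x q))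
      ((mfderiv 𝓘(ℝ, E) 𝓘(ℝ, E) (extChartAt 𝓘(ℝ, E) p) (f q)).comp
        (mfderiv 𝓘(ℝ, E') 𝓘(ℝ, E) f q)) := by
    rw [hsymm]
    exact h2.hasMFDerivAt.comp q hf.hasMFDerivAt
  have h4 := (h3.comp _ h1.hasMFDerivAt).mfderiv
  rw [mfderiv_eq_fderiv, Function.comp_assoc] at h4
  rw [h4, ← symmL_trivializationAt_apply hp (mfderiv 𝓘(ℝ, E') 𝓘(ℝ, E) f q _),
    ← Trivialization.continuousLinearMapAt_apply_of_mem (R := ℝ)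
      (trivializationAt E (TangentSpace 𝓘(ℝ, E)) p) (b := f q) hp,
    TangentBundle.continuousLinearMapAt_trivializationAt hp,
    TangentBundle.symmL_trivializationAt hq]
  simp only [modelWithCornersSelf_coe, Set.range_id, mfderivWithin_univ]
  rfl

/-- The coordinates of the velocity of a curve. -/
lemma trivializationAt_velocity {c : ℝ → N} {p : N} {t : ℝ} (hp : c t ∈ (chartAt E p).source)
    (hc : MDifferentiableAt 𝓘(ℝ, ℝ) 𝓘(ℝ, E) c t) :
    (trivializationAt E (TangentSpace 𝓘(ℝ, E)) p ⟨c t, velocity (E := E) c t⟩).2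
      = deriv (extChartAt 𝓘(ℝ, E) p ∘ c) t := by
  have h2 : MDifferentiableAt 𝓘(ℝ, E) 𝓘(ℝ, E) (extChartAt 𝓘(ℝ, E) p) (c t) :=
    mdifferentiableAt_extChartAt hp
  rw [← Trivialization.continuousLinearMapAt_apply_of_mem (R := ℝ)
      (trivializationAt E (TangentSpace 𝓘(ℝ, E)) p) (b := c t) hp,
    TangentBundle.continuousLinearMapAt_trivializationAt hp, ← fderiv_apply_one_eq_deriv,
    ← mfderiv_eq_fderiv, mfderiv_comp t h2 hc]
  rfl

lemma contDiffAt_extChartAt_comp {c : ℝ → N} {p : N} {t : ℝ} (hp : c t ∈ (chartAt E p).source)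
    (hc : ContMDiffAt 𝓘(ℝ, ℝ) 𝓘(ℝ, E) ∞ c t) :
    ContDiffAt ℝ ∞ (extChartAt 𝓘(ℝ, E) p ∘ c) t :=
  ((contMDiffAt_extChartAt' hp).comp t hc).contDiffAt

variable [RiemannianBundle (fun x : N ↦ TangentSpace 𝓘(ℝ, E) x)]

/-- Holds for every `y`, even outside the chart target, since the form is always an inner product
composed with a linear map. -/
lemma metricInChart_symm (x : N) (y u v : E) :
    metricInChart x y u v = metricInChart x y v u := by
  simp only [metricInChart, ContinuousLinearMap.bilinearComp_apply]
  exact real_inner_comm (F := TangentSpace 𝓘(ℝ, E) ((extChartAt 𝓘(ℝ, E) x).symm y)) _ _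

lemma metricInChart_extChartAt {x q : N} (hq : q ∈ (chartAt E x).source) (u v : E) :
    metricInChart x (extChartAt 𝓘(ℝ, E) x q) u v =
      inner ℝ ((trivializationAt E (TangentSpace 𝓘(ℝ, E)) x).symmL ℝ q u)
        ((trivializationAt E (TangentSpace 𝓘(ℝ, E)) x).symmL ℝ q v) := by
  have h : (extChartAt 𝓘(ℝ, E) x).symm (extChartAt 𝓘(ℝ, E) x q) = q :=
    (extChartAt 𝓘(ℝ, E) x).left_inv (by simpa using hq)
  unfold metricInChart
  rw [h]
  rfl

lemma metricInChart_self (x : N) (u v : TangentSpace 𝓘(ℝ, E) x) :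
    metricInChart x (extChartAt 𝓘(ℝ, E) x x) u v = inner ℝ u v := by
  have h := metricInChart_extChartAt (mem_chart_source E x) u v
  rwa [symmL_trivializationAt_self (E := E) x u, symmL_trivializationAt_self (E := E) x v] at h

lemma metricInChart_coord {x q : N} (hq : q ∈ (chartAt E x).source)
    (u v : TangentSpace 𝓘(ℝ, E) q) :
    metricInChart x (extChartAt 𝓘(ℝ, E) x q)
      (trivializationAt E (TangentSpace 𝓘(ℝ, E)) x ⟨q, u⟩).2
      (trivializationAt E (TangentSpace 𝓘(ℝ, E)) x ⟨q, v⟩).2 = inner ℝ u v := by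
  rw [metricInChart_extChartAt hq, symmL_trivializationAt_apply hq,
    symmL_trivializationAt_apply hq]

lemma metricInChart_christoffel [FiniteDimensional ℝ E] (x : N)
    (u v w : TangentSpace 𝓘(ℝ, E) x) :
    metricInChart x (extChartAt 𝓘(ℝ, E) x x) (christoffel x u v) w =
      christoffelLower (E := E) (metricInChart x) (extChartAt 𝓘(ℝ, E) x x) u v w := by
  have : FiniteDimensional ℝ (TangentSpace 𝓘(ℝ, E) x) := inferInstanceAs (FiniteDimensional ℝ E)
  have : CompleteSpace (TangentSpace 𝓘(ℝ, E) x) := FiniteDimensional.complete ℝ _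
  rw [metricInChart_self]
  exact InnerProductSpace.toDual_symm_apply

/-- As `E` is finite-dimensional, it is enough to fix `u` and `v`; the entry is then the inner
product of two smooth coordinate fields. -/
lemma differentiableAt_metricInChart [FiniteDimensional ℝ E]
    [IsContMDiffRiemannianBundle 𝓘(ℝ, E) ∞ E (fun x : N ↦ TangentSpace 𝓘(ℝ, E) x)] (x : N) :
    DifferentiableAt ℝ (metricInChart (E := E) x) (extChartAt 𝓘(ℝ, E) x x) := by
  have key : ContDiffOn ℝ 1 (metricInChart (E := E) x) (extChartAt 𝓘(ℝ, E) x).target := by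
    refine contDiffOn_clm_apply.2 fun u ↦ contDiffOn_clm_apply.2 fun v ↦ ?_
    have coord : ∀ w : E, ContMDiffOn 𝓘(ℝ, E) 𝓘(ℝ, E).tangent ∞ (fun y : E ↦
        (⟨(extChartAt 𝓘(ℝ, E) x).symm y, (trivializationAt E (TangentSpace 𝓘(ℝ, E)) x).symmL ℝ
          ((extChartAt 𝓘(ℝ, E) x).symm y) w⟩ : TangentBundle 𝓘(ℝ, E) N))
        (extChartAt 𝓘(ℝ, E) x).target := by
      intro w y hy
      have hq : (extChartAt 𝓘(ℝ, E) x).symm y ∈ (chartAt E x).source := by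
        simpa using (extChartAt 𝓘(ℝ, E) x).map_target hy
      refine (ContMDiffAt.comp_contMDiffWithinAt (g := fun q : N ↦
        (⟨q, (trivializationAt E (TangentSpace 𝓘(ℝ, E)) x).symmL ℝ q w⟩ :
          TangentBundle 𝓘(ℝ, E) N)) y ?_ (contMDiffOn_extChartAt_symm x y hy))
      refine ((trivializationAt E (TangentSpace 𝓘(ℝ, E)) x).contMDiffAt_section_iff hq).2 ?_
      -- Read in the trivialization at `x`, the coordinate field is constant.
      refine (contMDiffAt_const (c := w)).congr_of_eventuallyEq ?_
      filter_upwards [(chartAt E x).open_source.mem_nhds hq] with z hz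
      rw [Trivialization.symmL_apply _ hz, Trivialization.apply_mk_symm _ hz]
    intro y hy
    have h := ContMDiffWithinAt.inner_bundle (F := E)
      (E := fun x : N ↦ TangentSpace 𝓘(ℝ, E) x) (coord u y hy) (coord v y hy)
    exact h.contDiffWithinAt.of_le (by simp)
  exact (key.contDiffAt (extChartAt_target_mem_nhds x)).differentiableAt one_ne_zero

end Charts

lemma mem_of_mem_orthogonal_orthogonal {V : Type*} [NormedAddCommGroup V] [InnerProductSpace ℝ V]
    [FiniteDimensional ℝ V] {K : Submodule ℝ V} {v : V} (h : v ∈ Kᗮᗮ) : v ∈ K := by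
  rwa [Submodule.orthogonal_orthogonal] at h

/-- The velocity of `ι ∘ γ` is the image of the velocity of `γ`. -/
lemma velocity_comp {E' : Type*} [NormedAddCommGroup E'] [NormedSpace ℝ E']
    {M : Type*} [TopologicalSpace M] [ChartedSpace E' M]
    {E : Type*} [NormedAddCommGroup E] [NormedSpace ℝ E]
    {N : Type*} [TopologicalSpace N] [ChartedSpace E N]
    {ι : M → N} {γ : ℝ → M} {t : ℝ}
    (hι : MDifferentiableAt 𝓘(ℝ, E') 𝓘(ℝ, E) ι (γ t))
    (hγ : MDifferentiableAt 𝓘(ℝ, ℝ) 𝓘(ℝ, E') γ t) :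
    velocity (E := E) (ι ∘ γ) t = mfderiv 𝓘(ℝ, E') 𝓘(ℝ, E) ι (γ t) (velocity (E := E') γ t) := by
  unfold velocity
  rw [mfderiv_comp t hι hγ]
  rfl

/-! ### Velocity and acceleration of a curve in a chart -/

section Curves

variable {E : Type*} [NormedAddCommGroup E] [NormedSpace ℝ E]
  {N : Type*} [TopologicalSpace N] [ChartedSpace E N] [IsManifold 𝓘(ℝ, E) ∞ N]

lemma eventually_mdifferentiableAt {c : ℝ → N} {t : ℝ}
    (hc : ContMDiffAt 𝓘(ℝ, ℝ) 𝓘(ℝ, E) ∞ c t) :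
    ∀ᶠ s in 𝓝 t, MDifferentiableAt 𝓘(ℝ, ℝ) 𝓘(ℝ, E) c s :=
  ((contMDiffAt_iff_contMDiffAt_nhds (by simp)).1 (hc.of_le (m := 1) (by simp))).mono
    fun _ h ↦ h.mdifferentiableAt (by simp)

/-- The chart stays fixed at `c t` while `s` varies, so that the identity can be differentiated at
`t`. -/
lemma eventually_trivializationAt_velocity {c : ℝ → N} {t : ℝ}
    (hc : ContMDiffAt 𝓘(ℝ, ℝ) 𝓘(ℝ, E) ∞ c t) :
    ∀ᶠ s in 𝓝 t,
      (trivializationAt E (TangentSpace 𝓘(ℝ, E)) (c t) ⟨c s, velocity (E := E) c s⟩).2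
        = deriv (extChartAt 𝓘(ℝ, E) (c t) ∘ c) s := by
  filter_upwards [eventually_mdifferentiableAt hc,
    hc.continuousAt.eventually (chart_source_mem_nhds E (c t))] with s hs hs'
  exact trivializationAt_velocity hs' hs

lemma velocity_eq_deriv {c : ℝ → N} {t : ℝ} (hc : ContMDiffAt 𝓘(ℝ, ℝ) 𝓘(ℝ, E) ∞ c t) :
    velocity (E := E) c t = deriv (extChartAt 𝓘(ℝ, E) (c t) ∘ c) t := by
  have h := (eventually_trivializationAt_velocity hc).self_of_nhds
  rwa [trivializationAt_apply_self] at h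

variable [FiniteDimensional ℝ E] [RiemannianBundle (fun x : N ↦ TangentSpace 𝓘(ℝ, E) x)]

/-- The Christoffel symbols at `x` in coordinates. -/
def christoffelCoord (x : N) (u v : E) : E := christoffel (N := N) x u v

/-- The acceleration of a curve in the preferred chart. -/
lemma covDerivAlong_velocity {c : ℝ → N} {t : ℝ} (hc : ContMDiffAt 𝓘(ℝ, ℝ) 𝓘(ℝ, E) ∞ c t) :
    covDerivAlong (F := ℝ) c (velocity (E := E) c) t (1 : ℝ)
      = (deriv (deriv (extChartAt 𝓘(ℝ, E) (c t) ∘ c)) t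
        + christoffelCoord (c t) (deriv (extChartAt 𝓘(ℝ, E) (c t) ∘ c) t)
          (deriv (extChartAt 𝓘(ℝ, E) (c t) ∘ c) t) : E) := by
  have h := Filter.EventuallyEq.deriv_eq (eventually_trivializationAt_velocity hc)
  have hv := velocity_eq_deriv hc
  rw [← h]
  simp only [covDerivAlong]
  rw [← hv, mfderiv_eq_fderiv]
  rfl

lemma inner_acceleration {c : ℝ → N} {t : ℝ} (hc : ContMDiffAt 𝓘(ℝ, ℝ) 𝓘(ℝ, E) ∞ c t)
    (w : TangentSpace 𝓘(ℝ, E) (c t)) :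
    inner ℝ (covDerivAlong (F := ℝ) c (velocity (E := E) c) t (1 : ℝ)) w
      = metricInChart (c t) (extChartAt 𝓘(ℝ, E) (c t) (c t))
        (deriv (deriv (extChartAt 𝓘(ℝ, E) (c t) ∘ c)) t
          + christoffelCoord (c t) (deriv (extChartAt 𝓘(ℝ, E) (c t) ∘ c) t)
            (deriv (extChartAt 𝓘(ℝ, E) (c t) ∘ c) t)) w := by
  rw [← covDerivAlong_velocity hc]
  exact (metricInChart_self (c t) _ w).symm

end Curves

/-! ### Normal and tangential parts of the acceleration -/

section Submanifold

variable {E' : Type*} [NormedAddCommGroup E'] [NormedSpace ℝ E']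
  {M : Type*} [TopologicalSpace M] [ChartedSpace E' M]
  {E : Type*} [NormedAddCommGroup E] [NormedSpace ℝ E] [FiniteDimensional ℝ E]
  {N : Type*} [TopologicalSpace N] [ChartedSpace E N] [IsManifold 𝓘(ℝ, E) ∞ N]

variable [RiemannianBundle (fun x : N ↦ TangentSpace 𝓘(ℝ, E) x)]

/-- The restriction to a curve of a parallel field, in coordinates. -/
lemma hasDerivAt_of_parallel {ι : M → N} {γ : ℝ → M} {t : ℝ}
    (hι : ContMDiff 𝓘(ℝ, E') 𝓘(ℝ, E) ∞ ι) (hγ : ContMDiffAt 𝓘(ℝ, ℝ) 𝓘(ℝ, E') ∞ γ t)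
    {Y : ∀ x : M, TangentSpace 𝓘(ℝ, E) (ι x)} (hY : IsParallelAlong (F := E') ι Y) :
    HasDerivAt (fun s ↦
        (trivializationAt E (TangentSpace 𝓘(ℝ, E)) (ι (γ t)) ⟨ι (γ s), Y (γ s)⟩).2)
      (- christoffelCoord (ι (γ t)) (deriv (extChartAt 𝓘(ℝ, E) (ι (γ t)) ∘ ι ∘ γ) t)
        (trivializationAt E (TangentSpace 𝓘(ℝ, E)) (ι (γ t)) ⟨ι (γ t), Y (γ t)⟩).2) t := by
  have hc : ContMDiffAt 𝓘(ℝ, ℝ) 𝓘(ℝ, E) ∞ (ι ∘ γ) t := (hι _).comp t hγ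
  have hγ1 := hγ.mdifferentiableAt (by simp)
  have hYt := trivializationAt_apply_self (ι (γ t)) (Y (γ t))
  have hYc : MDifferentiableAt 𝓘(ℝ, E') 𝓘(ℝ, E) (fun q ↦
      (trivializationAt E (TangentSpace 𝓘(ℝ, E)) (ι (γ t)) ⟨ι q, Y q⟩).2) (γ t) :=
    (contMDiffAt_totalSpace.1 (hY.smooth (γ t))).2.mdifferentiableAt (by simp)
  -- In the direction `γ'`, parallelism says that the derivative of the coordinates of `Y` is `-Γ((ι
  -- ∘ γ)', Y)`; the chain rule turns this into a derivative along `γ`.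
  have h1 := hY.parallel (γ t) (velocity (E := E') γ t)
  simp only [covDerivAlong] at h1
  rw [← velocity_comp ((hι (γ t)).mdifferentiableAt (by simp)) hγ1, velocity_eq_deriv hc] at h1
  have h2 := (hYc.comp t hγ1).differentiableAt.hasDerivAt
  rw [← fderiv_apply_one_eq_deriv, ← mfderiv_eq_fderiv, mfderiv_comp t hYc hγ1] at h2
  rw [hYt]
  have h3 := eq_neg_of_add_eq_zero_left h1
  exact h3 ▸ h2

variable [IsManifold 𝓘(ℝ, E') ∞ M]
  [IsContMDiffRiemannianBundle 𝓘(ℝ, E) ∞ E (fun x : N ↦ TangentSpace 𝓘(ℝ, E) x)]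

/-- The acceleration of a curve of `M` is orthogonal to every parallel field along `M` which is
normal to `M`. -/
lemma inner_acceleration_parallel {ι : M → N} {γ : ℝ → M} {t : ℝ}
    (hι : ContMDiff 𝓘(ℝ, E') 𝓘(ℝ, E) ∞ ι) (hγ : ContMDiffAt 𝓘(ℝ, ℝ) 𝓘(ℝ, E') ∞ γ t)
    {Y : ∀ x : M, TangentSpace 𝓘(ℝ, E) (ι x)} (hY : IsParallelAlong (F := E') ι Y)
    (hn : ∀ x, Y x ∈ normalSpace (E' := E') ι x) :
    inner ℝ (covDerivAlong (F := ℝ) (ι ∘ γ) (velocity (E := E) (ι ∘ γ)) t (1 : ℝ))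
      (Y (γ t)) = 0 := by
  have hc : ContMDiffAt 𝓘(ℝ, ℝ) 𝓘(ℝ, E) ∞ (ι ∘ γ) t := (hι _).comp t hγ
  have hcd : ContDiffAt ℝ 2 (extChartAt 𝓘(ℝ, E) (ι (γ t)) ∘ ι ∘ γ) t :=
    (contDiffAt_extChartAt_comp (mem_chart_source E _) hc).of_le (by norm_cast)
  have horth : ∀ᶠ s in 𝓝 t, metricInChart (ι (γ t)) (extChartAt 𝓘(ℝ, E) (ι (γ t)) (ι (γ s)))
      (deriv (extChartAt 𝓘(ℝ, E) (ι (γ t)) ∘ ι ∘ γ) s)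
      (trivializationAt E (TangentSpace 𝓘(ℝ, E)) (ι (γ t)) ⟨ι (γ s), Y (γ s)⟩).2 = 0 := by
    filter_upwards [eventually_trivializationAt_velocity hc, eventually_mdifferentiableAt hγ,
      hc.continuousAt.eventually (chart_source_mem_nhds E (ι (γ t)))] with s h1 h2 h3
    have h4 := metricInChart_coord h3 (velocity (E := E) (ι ∘ γ) s) (Y (γ s))
    simp only [Function.comp_apply] at h1 h4
    rw [h1] at h4
    refine h4.trans ?_
    rw [velocity_comp ((hι _).mdifferentiableAt (by simp)) h2]
    exact (Submodule.mem_orthogonal _ _).1 (hn (γ s)) _ ⟨_, rfl⟩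
  have h := acceleration_orthogonal_of_parallel (g := metricInChart (ι (γ t)))
    (c := extChartAt 𝓘(ℝ, E) (ι (γ t)) ∘ ι ∘ γ) (Γ := christoffelCoord (ι (γ t)))
    (differentiableAt_metricInChart (ι (γ t))) (metricInChart_symm _)
    (metricInChart_christoffel (ι (γ t))) (hcd.differentiableAt (by norm_num))
    (differentiableAt_deriv hcd) (hasDerivAt_of_parallel hι hγ hY) horth
  rw [trivializationAt_apply_self] at h
  exact (inner_acceleration hc (Y (γ t))).trans h

variable [FiniteDimensional ℝ E'] [RiemannianBundle (fun x : M ↦ TangentSpace 𝓘(ℝ, E') x)]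
  [IsContMDiffRiemannianBundle 𝓘(ℝ, E') ∞ E' (fun x : M ↦ TangentSpace 𝓘(ℝ, E') x)]

/-- The tangential component of the acceleration of `ι ∘ γ` is the acceleration of `γ`. -/
lemma inner_acceleration_mfderiv {ι : M → N} {γ : ℝ → M} {t : ℝ}
    (hι : IsRiemannianSubmanifold (E' := E') (E := E) ι)
    (hγ : ContMDiffAt 𝓘(ℝ, ℝ) 𝓘(ℝ, E') ∞ γ t) (w : TangentSpace 𝓘(ℝ, E') (γ t)) :
    inner ℝ (covDerivAlong (F := ℝ) (ι ∘ γ) (velocity (E := E) (ι ∘ γ)) t (1 : ℝ))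
        (mfderiv 𝓘(ℝ, E') 𝓘(ℝ, E) ι (γ t) w)
      = inner ℝ (covDerivAlong (F := ℝ) γ (velocity (E := E') γ) t (1 : ℝ)) w := by
  have hιs : ContMDiff 𝓘(ℝ, E') 𝓘(ℝ, E) ∞ ι := hι.immersion.contMDiff
  have hc : ContMDiffAt 𝓘(ℝ, ℝ) 𝓘(ℝ, E) ∞ (ι ∘ γ) t := (hιs _).comp t hγ
  have hιd : ∀ q, MDifferentiableAt 𝓘(ℝ, E') 𝓘(ℝ, E) ι q := fun q ↦
    (hιs q).mdifferentiableAt (by simp)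
  have hγd : ContDiffAt ℝ 2 (extChartAt 𝓘(ℝ, E') (γ t) ∘ γ) t :=
    (contDiffAt_extChartAt_comp (mem_chart_source E' _) hγ).of_le (by norm_cast)
  set f : E' → E := extChartAt 𝓘(ℝ, E) (ι (γ t)) ∘ ι ∘ (extChartAt 𝓘(ℝ, E') (γ t)).symm
  have hft : f (extChartAt 𝓘(ℝ, E') (γ t) (γ t)) = extChartAt 𝓘(ℝ, E) (ι (γ t)) (ι (γ t)) := by
    simp [f]
  have hfd : ContDiffAt ℝ 2 f (extChartAt 𝓘(ℝ, E') (γ t) (γ t)) := by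
    have h := (contMDiffAt_iff.1 (hιs (γ t))).2
    simp only [modelWithCornersSelf_coe, Set.range_id, contDiffWithinAt_univ] at h
    exact h.of_le (by norm_cast)
  have hfm : ∀ u, (mfderiv 𝓘(ℝ, E') 𝓘(ℝ, E) ι (γ t) u : E) =
      fderiv ℝ f (extChartAt 𝓘(ℝ, E') (γ t) (γ t)) u := fun u ↦ by
    have h := mfderiv_symmL (mem_chart_source E' (γ t)) (mem_chart_source E (ι (γ t)))
      (hιd (γ t)) u
    rwa [symmL_trivializationAt_self (E := E') (γ t) u,
      symmL_trivializationAt_self (E := E) (ι (γ t)) _] at h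
  -- The chart of `M` cancels only near `t`, which suffices for first and second derivatives at `t`.
  have hcomp : f ∘ (extChartAt 𝓘(ℝ, E') (γ t) ∘ γ) =ᶠ[𝓝 t]
      extChartAt 𝓘(ℝ, E) (ι (γ t)) ∘ ι ∘ γ := by
    filter_upwards [hγ.continuousAt.eventually (extChartAt_source_mem_nhds (I := 𝓘(ℝ, E')) (γ t))]
      with s hs
    simp only [f, Function.comp_apply]
    rw [(extChartAt 𝓘(ℝ, E') (γ t)).left_inv hs]
  -- The isometry condition on `ι`, written in the two charts.
  have hpull : ∀ᶠ z in 𝓝 (extChartAt 𝓘(ℝ, E') (γ t) (γ t)), ∀ u v,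
      metricInChart (γ t) z u v =
        metricInChart (ι (γ t)) (f z) (fderiv ℝ f z u) (fderiv ℝ f z v) := by
    have hcont : ContinuousAt (ι ∘ (extChartAt 𝓘(ℝ, E') (γ t)).symm)
        (extChartAt 𝓘(ℝ, E') (γ t) (γ t)) :=
      hιs.continuous.continuousAt.comp (continuousAt_extChartAt_symm (γ t))
    have hev : ∀ᶠ z in 𝓝 (extChartAt 𝓘(ℝ, E') (γ t) (γ t)),
        ι ((extChartAt 𝓘(ℝ, E') (γ t)).symm z) ∈ (chartAt E (ι (γ t))).source :=
      hcont.eventually ((chartAt E (ι (γ t))).open_source.mem_nhds (by simp))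
    filter_upwards [extChartAt_target_mem_nhds (I := 𝓘(ℝ, E')) (γ t), hev] with z hz hz' u v
    have hq : (extChartAt 𝓘(ℝ, E') (γ t)).symm z ∈ (chartAt E' (γ t)).source := by
      simpa using (extChartAt 𝓘(ℝ, E') (γ t)).map_target hz
    have hzz := (extChartAt 𝓘(ℝ, E') (γ t)).right_inv hz
    have h1 := metricInChart_extChartAt hq u v
    have h2 := fun a ↦ mfderiv_symmL hq hz' (hιd _) a
    rw [← hι.isometric, h2, h2, hzz, ← metricInChart_extChartAt hz'] at h1
    exact h1
  have h := acceleration_comp (g := metricInChart (ι (γ t))) (h := metricInChart (γ t))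
    (f := f) (c := extChartAt 𝓘(ℝ, E') (γ t) ∘ γ) (t := t)
    (Γ := christoffelCoord (ι (γ t)))
    (Γ' := christoffelCoord (γ t)) hfd
    (by
      simp only [Function.comp_apply]
      rw [hft]
      exact differentiableAt_metricInChart (ι (γ t)))
    (differentiableAt_metricInChart (γ t)) (metricInChart_symm _) hpull
    (by
      simp only [Function.comp_apply]
      rw [hft]
      exact metricInChart_christoffel (ι (γ t)))
    (metricInChart_christoffel (γ t)) hγd w
  rw [hcomp.deriv.deriv_eq, hcomp.deriv_eq] at h
  simp only [Function.comp_apply] at h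
  rw [hft] at h
  rw [← hfm] at h
  exact (inner_acceleration hc _).trans (h.trans (inner_acceleration hγ w).symm)

end Submanifold

end RiemSub

end

theorem mainTheorem7
    {E' : Type*} [NormedAddCommGroup E'] [NormedSpace ℝ E'] [FiniteDimensional ℝ E']
    {M : Type*} [TopologicalSpace M] [ChartedSpace E' M] [IsManifold 𝓘(ℝ, E') ∞ M]
    [RiemannianBundle (fun x : M ↦ TangentSpace 𝓘(ℝ, E') x)]
    [IsContMDiffRiemannianBundle 𝓘(ℝ, E') ∞ E' (fun x : M ↦ TangentSpace 𝓘(ℝ, E') x)]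
    {E : Type*} [NormedAddCommGroup E] [NormedSpace ℝ E] [FiniteDimensional ℝ E]
    {N : Type*} [TopologicalSpace N] [ChartedSpace E N] [IsManifold 𝓘(ℝ, E) ∞ N]
    [RiemannianBundle (fun x : N ↦ TangentSpace 𝓘(ℝ, E) x)]
    [IsContMDiffRiemannianBundle 𝓘(ℝ, E) ∞ E (fun x : N ↦ TangentSpace 𝓘(ℝ, E) x)]
    (ι : M → N) (hι : RiemSub.IsRiemannianSubmanifold (E' := E') (E := E) ι)
    (r : ℕ) (hr : Module.finrank ℝ E = Module.finrank ℝ E' + r)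
    (X : Fin r → ∀ x : M, TangentSpace 𝓘(ℝ, E) (ι x))
    (hX : ∀ j, RiemSub.IsParallelAlong (F := E') ι (X j))
    (hlin : ∀ x : M, LinearIndependent ℝ (fun j ↦ X j x))
    (hspan : ∀ x : M,
      Submodule.span ℝ (Set.range fun j ↦ X j x) = RiemSub.normalSpace (E' := E') ι x) :
    RiemSub.IsTotallyGeodesic (E' := E') (E := E) ι := by
  intro γ J hJ _ hγ
  have hιs : ContMDiff 𝓘(ℝ, E') 𝓘(ℝ, E) ∞ ι := hι.immersion.contMDiff
  refine ⟨hιs.comp_contMDiffOn hγ.smooth, fun t ht ↦ ?_⟩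
  have hγt := hγ.smooth.contMDiffAt (hJ.mem_nhds ht)
  have : FiniteDimensional ℝ (TangentSpace 𝓘(ℝ, E) ((ι ∘ γ) t)) :=
    inferInstanceAs (FiniteDimensional ℝ E)
  set D := RiemSub.covDerivAlong (F := ℝ) (ι ∘ γ) (RiemSub.velocity (E := E) (ι ∘ γ)) t (1 : ℝ)
    with hD
  have hperp : D ∈ (RiemSub.normalSpace (E' := E') ι (γ t))ᗮ := by
    rw [← hspan, Submodule.mem_orthogonal']
    intro u hu
    refine Submodule.span_induction ?_ (inner_zero_right _) (fun a b _ _ ha hb ↦ ?_)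
      (fun a b _ hb ↦ ?_) hu
    · rintro _ ⟨j, rfl⟩
      exact RiemSub.inner_acceleration_parallel hιs hγt (hX j)
        fun x ↦ hspan x ▸ Submodule.subset_span ⟨j, rfl⟩
    · rw [inner_add_right, ha, hb, add_zero]
    · rw [inner_smul_right, hb, mul_zero]
  -- The normal space is the orthogonal of the range of `dι`, and in finite dimension the double
  -- orthogonal is that range itself.
  obtain ⟨w, hw⟩ := RiemSub.mem_of_mem_orthogonal_orthogonal hperp
  have h := RiemSub.inner_acceleration_mfderiv hι hγt w
  rw [hγ.geodesic t ht, inner_zero_left, ← hD] at h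
  have hw' : mfderiv 𝓘(ℝ, E') 𝓘(ℝ, E) ι (γ t) w = D := hw
  rw [hw'] at h
  exact inner_self_eq_zero.1 h
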